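/- Let $(\Omega,\mathcal F,\mu)$ be a probability space, let $T:\Omega\to\Omega$ be an invertible, bi-measurable, $\mu$-preserving ergodic transformation, and let $c:\Omega\to(0,\infty)$ be measurable. For $\omega\in\Omega$ and $x\in\mathbb Z$ put $c(x,x+1)=c(x+1,x)=c(T^x\omega)$ and $\bar c(x)=c(x-1,x)+c(x,x+1)$, and write $\int\bar c\,d\mu$ for the integral of $\omega\mapsto\bar c(0)(\omega)$. Let $P$ be the transition operator of the nearest-neighbour random walk on $\mathbb Z$ among these conductances, $$Pf(x)=f(x-1)\,\frac{c(x-1,x)}{\bar c(x)}+f(x+1)\,\frac{c(x,x+1)}{\bar c(x)},$$ and let $h_n=P^n\bigl(\tfrac1{\bar c(0)}\mathbf 1_{\{0\}}\bigr)$, $n\ge0$, be its heat kernel based at $0$. Finally let $B(x_0,r)=\{x\in\mathbb Z:|x-x_0|<r\}$. Assume that $1/c$ is $\mu$-integrable. Then for $\mu$-almost every $\omega$ and for every even integer $x_0$ there is a real $C>0$, depending on $\omega$ and $x_0$, such that for all real $\delta>0$ and all integers $n\ge1$ $$\max_{x\in B(x_0,\delta\sqrt{2n})\cap2\mathbb Z}|h_{2n}(x)-h_{2n}(x_0)|\le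 C\,\frac{\sqrt\delta}{\sqrt n}.$$ If moreover $\int\bar c\,d\mu=+\infty$, then for $\mu$-almost every $\omega$ and for every $x_0\in\mathbb Z$ $$\lim_{n\to\infty}\sqrt{2n}\,\max_{x\in B(x_0,\sqrt{2n})\cap2\mathbb Z}|h_{2n}(x)-h_{2n}(x_0)|=0.$$ -/

import Mathlib

open MeasureTheory Filter Topology

/-- The conductance `c(x, x+1)(ω) = c (T ^ x ω)` of the edge `{x, x+1}` of `ℤ` in the
environment `ω`. -/
def conductance {Ω : Type*} [MeasurableSpace Ω] (T : Ω ≃ᵐ Ω) (c : Ω → ℝ) (ω : Ω) (x : ℤ) : ℝ :=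
  c (((T.toEquiv : Equiv.Perm Ω) ^ x) ω)

/-- The total conductance `c̄(x) = c(x-1, x) + c(x, x+1)` at the site `x`; here `a x` is the
conductance of the edge `{x, x+1}`. -/
def totalConductance (a : ℤ → ℝ) (x : ℤ) : ℝ :=
  a (x - 1) + a x

/-- The transition operator of the nearest-neighbour random walk among the conductances `a`:
`P f (x) = f (x-1) p(x, x-1) + f (x+1) p(x, x+1)`, where `p(x, x-1) = c(x-1, x) / c̄(x)` and
`p(x, x+1) = c(x, x+1) / c̄(x)`. -/
noncomputable def transitionOperator (a : ℤ → ℝ) (f : ℤ → ℝ) (x : ℤ) : ℝ :=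
  f (x - 1) * (a (x - 1) / totalConductance a x) + f (x + 1) * (a x / totalConductance a x)

/-- The heat kernel of the walk based at `0`: `h_n = P ^ n (𝟙_{0} / c̄(0))`. -/
noncomputable def heatKernel (a : ℤ → ℝ) (n : ℕ) : ℤ → ℝ :=
  (transitionOperator a)^[n] (fun x => if x = 0 then 1 / totalConductance a 0 else 0)

/-- `B(x₀, r) ∩ 2ℤ`, where `B(x₀, r)` is the set of integers `x` with `|x - x₀| < r`. -/
def evenBall (x₀ : ℤ) (r : ℝ) : Set ℤ :=
  {x : ℤ | |(x : ℝ) - (x₀ : ℝ)| < r ∧ Even x}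

theorem evenBall_finite (x₀ : ℤ) (r : ℝ) : (evenBall x₀ r).Finite := by
  refine (Set.finite_Icc (x₀ - ⌈r⌉) (x₀ + ⌈r⌉)).subset ?_
  rintro x ⟨hx, -⟩
  have h1 := abs_lt.mp hx
  have h2 := Int.le_ceil r
  constructor
  · have : ((x₀ - ⌈r⌉ : ℤ) : ℝ) ≤ (x : ℝ) := by push_cast; linarith
    exact_mod_cast this
  · have : (x : ℝ) ≤ ((x₀ + ⌈r⌉ : ℤ) : ℝ) := by push_cast; linarith
    exact_mod_cast this

/-- The maximum over `x ∈ B(x₀, r) ∩ 2ℤ` of `|h x - h x₀|`. -/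
noncomputable def maxOscillation (h : ℤ → ℝ) (x₀ : ℤ) (r : ℝ) : ℝ :=
  sSup ((fun x => |h x - h x₀|) '' evenBall x₀ r)

/-- On a nonempty `B(x₀, r) ∩ 2ℤ`, `maxOscillation` is an attained maximum. -/
theorem maxOscillation_isGreatest (h : ℤ → ℝ) (x₀ : ℤ) (r : ℝ) (hne : (evenBall x₀ r).Nonempty) :
    IsGreatest ((fun x => |h x - h x₀|) '' evenBall x₀ r) (maxOscillation h x₀ r) :=
  ⟨(hne.image _).csSup_mem ((evenBall_finite x₀ r).image _),
    fun _ hy => le_csSup ((evenBall_finite x₀ r).image _).bddAbove hy⟩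

/-! ### Finitely supported functions and the transition operator -/

/-! Two steps of the walk form a network on each parity class. The energy of `h_n` in it equals
`h_{2n}(0) - h_{2n+2}(0)` and decreases in `n`, so `n` times the energy of `h_{2n}` is at most
`h_{2n}(0)`. Cauchy–Schwarz along a path then gives `n |h_{2n}(x) - h_{2n}(y)|² ≤ h_{2n}(0) R` for
`x - y` even, where `R` is the sum of `1/c` over a box containing both sites
(`nat_mul_sq_heatKernel_sub_le`).

Ergodicity enters through two facts: `R ≤ K M` on `[-M, M]` when `1/c` is integrable, and
superlinear growth of the box's conductance when `c̄` has infinite mean. Both follow from a maximal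
ergodic theorem.

The total mass is `1`, so `h_{2n}` cannot be large on a whole box of radius of order `√n`. With the
oscillation bound this controls `√n h_{2n}(0)` (`sqrt_mul_heatKernel_le`): it is bounded in general,
and tends to `0` in the infinite-mean case, where a box of radius `ε√n` suffices. Inserting this
into the oscillation bound gives both claims. -/

lemma summable_of_eq_zero_of_lt_natAbs {g : ℤ → ℝ} (N : ℕ) (h : ∀ x : ℤ, N < x.natAbs → g x = 0) :
    Summable g := by
  refine summable_of_ne_finset_zero (s := Finset.Icc (-(N : ℤ)) N) fun x hx => h x ?_
  rw [Finset.mem_Icc] at hx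
  omega

lemma tsum_int_add_one (g : ℤ → ℝ) : ∑' x, g (x + 1) = ∑' x, g x :=
  (Equiv.addRight (1 : ℤ)).tsum_eq g

lemma tsum_int_sub_one (g : ℤ → ℝ) : ∑' x, g (x - 1) = ∑' x, g x :=
  (Equiv.subRight (1 : ℤ)).tsum_eq g

section Walk

variable {a : ℤ → ℝ}

lemma totalConductance_pos (ha : ∀ x, 0 < a x) (x : ℤ) : 0 < totalConductance a x :=
  add_pos (ha _) (ha _)

lemma totalConductance_mul_transitionOperator (ha : ∀ x, 0 < a x) (f : ℤ → ℝ) (x : ℤ) :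
    totalConductance a x * transitionOperator a f x = f (x - 1) * a (x - 1) + f (x + 1) * a x := by
  have := (totalConductance_pos ha x).ne'
  unfold transitionOperator
  field_simp

lemma tsum_edge_eq_tsum_vertex {f : ℤ → ℝ} {N : ℕ} (hf : ∀ x : ℤ, N < x.natAbs → f x = 0) :
    ∑' z, a z * (f z + f (z + 1)) = ∑' x, totalConductance a x * f x := by
  have s1 : Summable fun z => a z * f z :=
    summable_of_eq_zero_of_lt_natAbs N fun x hx => by rw [hf x hx, mul_zero]
  have s2 : Summable fun z => a z * f (z + 1) :=
    summable_of_eq_zero_of_lt_natAbs (N + 1) fun x hx => by rw [hf _ (by omega), mul_zero]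
  have s3 : Summable fun z => a (z - 1) * f z :=
    summable_of_eq_zero_of_lt_natAbs N fun x hx => by rw [hf x hx, mul_zero]
  have e : ∑' z, a (z - 1) * f z = ∑' z, a z * f (z + 1) := by
    rw [← tsum_int_add_one]; simp
  simp only [totalConductance, mul_add, add_mul]
  rw [s1.tsum_add s2, s3.tsum_add s1, e, add_comm]

/-- `transitionOperator a` is symmetric with respect to the weights `totalConductance a`. -/
lemma tsum_transitionOperator_mul (ha : ∀ x, 0 < a x) {f : ℤ → ℝ} {N : ℕ}
    (hf : ∀ x : ℤ, N < x.natAbs → f x = 0) (g : ℤ → ℝ) :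
    ∑' x, totalConductance a x * (transitionOperator a f x * g x) =
      ∑' x, totalConductance a x * (f x * transitionOperator a g x) := by
  have h1 : ∀ x, totalConductance a x * (transitionOperator a f x * g x) =
      f (x - 1) * a (x - 1) * g x + f (x + 1) * a x * g x := fun x => by
    rw [← mul_assoc, totalConductance_mul_transitionOperator ha]; ring
  have h2 : ∀ x, totalConductance a x * (f x * transitionOperator a g x) =
      f x * a x * g (x + 1) + f x * a (x - 1) * g (x - 1) := fun x => by
    rw [mul_left_comm, totalConductance_mul_transitionOperator ha]; ring
  have s1 : Summable fun x => f (x - 1) * a (x - 1) * g x :=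
    summable_of_eq_zero_of_lt_natAbs (N + 1) fun x hx => by rw [hf _ (by omega)]; ring
  have s2 : Summable fun x => f (x + 1) * a x * g x :=
    summable_of_eq_zero_of_lt_natAbs (N + 1) fun x hx => by rw [hf _ (by omega)]; ring
  have s3 : Summable fun x => f x * a x * g (x + 1) :=
    summable_of_eq_zero_of_lt_natAbs N fun x hx => by rw [hf _ hx]; ring
  have s4 : Summable fun x => f x * a (x - 1) * g (x - 1) :=
    summable_of_eq_zero_of_lt_natAbs N fun x hx => by rw [hf _ hx]; ring
  have e1 : ∑' x, f (x - 1) * a (x - 1) * g x = ∑' x, f x * a x * g (x + 1) := by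
    rw [← tsum_int_add_one]; simp
  have e2 : ∑' x, f (x + 1) * a x * g x = ∑' x, f x * a (x - 1) * g (x - 1) := by
    rw [← tsum_int_sub_one]; simp
  simp only [h1, h2]
  rw [s1.tsum_add s2, s3.tsum_add s4, e1, e2]

/-- The conductance of the two-step walk between `y - 1` and `y + 1`. -/
noncomputable def twoStepConductance (a : ℤ → ℝ) (y : ℤ) : ℝ :=
  a (y - 1) * a y / totalConductance a y

/-- The Dirichlet form of the two-step walk. -/
noncomputable def twoStepEnergy (a : ℤ → ℝ) (f : ℤ → ℝ) : ℝ :=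
  ∑' y, twoStepConductance a y * (f (y + 1) - f (y - 1)) ^ 2

lemma twoStepConductance_pos (ha : ∀ x, 0 < a x) (y : ℤ) : 0 < twoStepConductance a y :=
  div_pos (mul_pos (ha _) (ha _)) (totalConductance_pos ha y)

lemma inv_twoStepConductance (ha : ∀ x, 0 < a x) (y : ℤ) :
    (twoStepConductance a y)⁻¹ = 1 / a (y - 1) + 1 / a y := by
  have h1 := (ha (y - 1)).ne'
  have h2 := (ha y).ne'
  unfold twoStepConductance totalConductance
  field_simp
  ring

/-- `transitionOperator a f y` is the weighted mean of `f (y - 1)` and `f (y + 1)`, and the energy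
term at `y` is `totalConductance a y` times the variance: second moment minus squared mean. -/
lemma twoStepEnergy_eq (ha : ∀ x, 0 < a x) {f : ℤ → ℝ} {N : ℕ}
    (hf : ∀ x : ℤ, N < x.natAbs → f x = 0) :
    twoStepEnergy a f = ∑' x, totalConductance a x * (f x * f x) -
      ∑' x, totalConductance a x * (transitionOperator a f x * transitionOperator a f x) := by
  have h : ∀ y, twoStepConductance a y * (f (y + 1) - f (y - 1)) ^ 2 =
      (a (y - 1) * f (y - 1) ^ 2 + a y * f (y + 1) ^ 2) -
        totalConductance a y * (transitionOperator a f y * transitionOperator a f y) := fun y => by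
    have h0 := (totalConductance_pos ha y).ne'
    have h1 : a (y - 1) = totalConductance a y - a y := by unfold totalConductance; ring
    unfold twoStepConductance transitionOperator
    rw [h1]
    field_simp
    ring
  have z : ∀ x : ℤ, N + 1 < x.natAbs → transitionOperator a f x = 0 := fun x hx => by
    unfold transitionOperator
    rw [hf _ (by omega), hf _ (by omega)]; ring
  have s1 : Summable fun y => a (y - 1) * f (y - 1) ^ 2 :=
    summable_of_eq_zero_of_lt_natAbs (N + 1) fun x hx => by rw [hf _ (by omega)]; ring
  have s2 : Summable fun y => a y * f (y + 1) ^ 2 :=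
    summable_of_eq_zero_of_lt_natAbs (N + 1) fun x hx => by rw [hf _ (by omega)]; ring
  have s3 : Summable fun y =>
      totalConductance a y * (transitionOperator a f y * transitionOperator a f y) :=
    summable_of_eq_zero_of_lt_natAbs (N + 1) fun x hx => by rw [z x hx]; ring
  have s4 : Summable fun y => a y * f y ^ 2 :=
    summable_of_eq_zero_of_lt_natAbs N fun x hx => by rw [hf _ hx]; ring
  have s5 : Summable fun y => a (y - 1) * f y ^ 2 :=
    summable_of_eq_zero_of_lt_natAbs N fun x hx => by rw [hf _ hx]; ring
  have e1 : ∑' y, a (y - 1) * f (y - 1) ^ 2 = ∑' y, a y * f y ^ 2 :=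
    tsum_int_sub_one fun y => a y * f y ^ 2
  have e2 : ∑' y, a y * f (y + 1) ^ 2 = ∑' y, a (y - 1) * f y ^ 2 := by
    rw [← tsum_int_sub_one]; simp
  have e3 : ∀ x, totalConductance a x * (f x * f x) = a (x - 1) * f x ^ 2 + a x * f x ^ 2 :=
    fun x => by unfold totalConductance; ring
  unfold twoStepEnergy
  simp only [h, e3]
  rw [(s1.add s2).tsum_sub s3, s1.tsum_add s2, s5.tsum_add s4, e1, e2, add_comm]

lemma summable_twoStepEnergy {f : ℤ → ℝ} {N : ℕ} (hf : ∀ x : ℤ, N < x.natAbs → f x = 0) :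
    Summable fun y => twoStepConductance a y * (f (y + 1) - f (y - 1)) ^ 2 :=
  summable_of_eq_zero_of_lt_natAbs (N + 1) fun x hx => by
    rw [hf _ (by omega), hf _ (by omega)]; ring

/-- Cauchy–Schwarz along `x, x + 2, …, x + 2m`. By the series law each two-step edge has the
resistance of the two edges it jumps over, so the resistances add up to those of the original path.
-/
lemma sq_sub_le_twoStepEnergy_mul_sum_range (ha : ∀ x, 0 < a x) {f : ℤ → ℝ} {N : ℕ}
    (hf : ∀ x : ℤ, N < x.natAbs → f x = 0) (x : ℤ) (m : ℕ) :
    (f (x + 2 * m) - f x) ^ 2 ≤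
      twoStepEnergy a f * ∑ i ∈ Finset.range (2 * m), 1 / a (x + i) := by
  have tel : f (x + 2 * m) - f x =
      ∑ j ∈ Finset.range m, (f (x + 2 * j + 1 + 1) - f (x + 2 * j + 1 - 1)) := by
    induction m with
    | zero => simp
    | succ k ih =>
      rw [Finset.sum_range_succ, ← ih]
      push_cast
      ring_nf
  have res : ∑ i ∈ Finset.range (2 * m), 1 / a (x + i) =
      ∑ j ∈ Finset.range m, (twoStepConductance a (x + 2 * j + 1))⁻¹ := by
    induction m with
    | zero => simp
    | succ k ih =>
      -- The induction hypothesis is conditional on the telescoping identity at `k`, which is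
      -- recovered from the one at `k + 1`.
      have tel' : f (x + 2 * k) - f x =
        ∑ j ∈ Finset.range k, (f (x + 2 * j + 1 + 1) - f (x + 2 * j + 1 - 1)) := by
        rw [Finset.sum_range_succ] at tel
        push_cast at tel
        ring_nf at tel ⊢
        linarith
      rw [Finset.sum_range_succ, ← ih tel', mul_add, mul_one, Finset.sum_range_succ,
        Finset.sum_range_succ, inv_twoStepConductance ha]
      push_cast
      ring_nf
  have pos := twoStepConductance_pos ha
  have inj : Function.Injective fun j : ℕ => x + 2 * (j : ℤ) + 1 := fun i j h => by
    simp only at h; omega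
  rw [tel, res]
  refine (Finset.sum_sq_le_sum_mul_sum_of_sq_le_mul _
    (f := fun j : ℕ => twoStepConductance a (x + 2 * j + 1) *
      (f (x + 2 * j + 1 + 1) - f (x + 2 * j + 1 - 1)) ^ 2)
    (g := fun j : ℕ => (twoStepConductance a (x + 2 * j + 1))⁻¹)
    (fun j _ => mul_nonneg (pos _).le (sq_nonneg _)) (fun j _ => (inv_pos.2 (pos _)).le)
    fun j _ => ?_).trans ?_
  · have := (pos (x + 2 * j + 1)).ne'
    refine le_of_eq ?_
    field_simp
  · refine mul_le_mul_of_nonneg_right ?_ (Finset.sum_nonneg fun j _ => (inv_pos.2 (pos _)).le)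
    rw [← Finset.sum_image (f := fun y => twoStepConductance a y * (f (y + 1) - f (y - 1)) ^ 2)
      (s := Finset.range m) (g := fun j : ℕ => x + 2 * (j : ℤ) + 1) inj.injOn]
    exact (summable_twoStepEnergy hf).sum_le_tsum _
      fun y _ => mul_nonneg (pos _).le (sq_nonneg _)

lemma twoStepEnergy_nonneg (ha : ∀ x, 0 < a x) (f : ℤ → ℝ) : 0 ≤ twoStepEnergy a f :=
  tsum_nonneg fun y => mul_nonneg (twoStepConductance_pos ha y).le (sq_nonneg _)

/-- The oscillation of `f` is controlled by its energy and the effective resistance. -/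
lemma sq_sub_le_twoStepEnergy_mul_resistance (ha : ∀ x, 0 < a x) {f : ℤ → ℝ} {N : ℕ}
    (hf : ∀ x : ℤ, N < x.natAbs → f x = 0) {x y : ℤ} (hxy : Even (x - y)) {M : ℕ}
    (hx : x.natAbs ≤ M) (hy : y.natAbs ≤ M) :
    (f x - f y) ^ 2 ≤ twoStepEnergy a f * ∑ z ∈ Finset.Ico (-(M : ℤ)) M, 1 / a z := by
  have key : ∀ (x : ℤ) (m : ℕ), x.natAbs ≤ M → (x + 2 * m).natAbs ≤ M →
      (f (x + 2 * m) - f x) ^ 2 ≤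
        twoStepEnergy a f * ∑ z ∈ Finset.Ico (-(M : ℤ)) M, 1 / a z := fun x m h1 h2 => by
    refine (sq_sub_le_twoStepEnergy_mul_sum_range ha hf x m).trans
      (mul_le_mul_of_nonneg_left ?_ (twoStepEnergy_nonneg ha f))
    have inj : Function.Injective fun j : ℕ => x + (j : ℤ) := fun i j h => by
      simp only at h; omega
    rw [← Finset.sum_image (f := fun z => 1 / a z) (g := fun j : ℕ => x + (j : ℤ)) inj.injOn]
    refine Finset.sum_le_sum_of_subset_of_nonneg (fun z hz => ?_)
      fun z _ _ => (one_div_pos.2 (ha z)).le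
    simp only [Finset.mem_image, Finset.mem_range, Finset.mem_Ico] at hz ⊢
    obtain ⟨i, hi, rfl⟩ := hz
    omega
  obtain ⟨k, hk⟩ := hxy
  rcases le_total 0 k with h | h
  · have e : x = y + 2 * (k.toNat : ℤ) := by omega
    rw [e] at hx ⊢
    exact key y _ hy hx
  · have e : y = x + 2 * ((-k).toNat : ℤ) := by omega
    rw [e] at hy ⊢
    rw [← neg_sub, neg_sq]
    exact key x _ hx hy

/-! ### The heat kernel -/

lemma heatKernel_succ (n : ℕ) : heatKernel a (n + 1) = transitionOperator a (heatKernel a n) := by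
  unfold heatKernel
  rw [Function.iterate_succ_apply']

lemma heatKernel_zero (x : ℤ) :
    heatKernel a 0 x = if x = 0 then 1 / totalConductance a 0 else 0 := rfl

lemma heatKernel_eq_zero_of_lt (n : ℕ) : ∀ x : ℤ, n < x.natAbs → heatKernel a n x = 0 := by
  induction n with
  | zero => intro x hx; rw [heatKernel_zero, if_neg (by omega)]
  | succ k ih =>
    intro x hx
    rw [heatKernel_succ, transitionOperator, ih _ (by omega), ih _ (by omega)]; ring

lemma heatKernel_eq_zero_of_odd (n : ℕ) : ∀ x : ℤ, Odd (x + n) → heatKernel a n x = 0 := by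
  induction n with
  | zero =>
    intro x hx
    rw [heatKernel_zero, if_neg (by rintro rfl; simp at hx)]
  | succ k ih =>
    intro x hx
    have h1 : Odd (x - 1 + k) := by push_cast at hx; grind
    have h2 : Odd (x + 1 + k) := by push_cast at hx; grind
    rw [heatKernel_succ, transitionOperator, ih _ h1, ih _ h2]; ring

lemma heatKernel_nonneg (ha : ∀ x, 0 < a x) (n : ℕ) : ∀ x, 0 ≤ heatKernel a n x := by
  have t := totalConductance_pos ha
  induction n with
  | zero =>
    intro x
    rw [heatKernel_zero]
    split_ifs
    exacts [(one_div_pos.2 (t 0)).le, le_rfl]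
  | succ k ih =>
    intro x
    rw [heatKernel_succ, transitionOperator]
    exact add_nonneg (mul_nonneg (ih _) (div_pos (ha _) (t _)).le)
      (mul_nonneg (ih _) (div_pos (ha _) (t _)).le)

lemma tsum_heatKernel_zero_mul (ha : ∀ x, 0 < a x) (g : ℤ → ℝ) :
    ∑' x, totalConductance a x * (heatKernel a 0 x * g x) = g 0 := by
  have := (totalConductance_pos ha 0).ne'
  rw [tsum_eq_single 0 fun x hx => by rw [heatKernel_zero, if_neg hx]; ring, heatKernel_zero,
    if_pos rfl]
  field_simp

lemma tsum_heatKernel (ha : ∀ x, 0 < a x) (n : ℕ) :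
    ∑' x, totalConductance a x * heatKernel a n x = 1 := by
  induction n with
  | zero => simpa using tsum_heatKernel_zero_mul ha fun _ => 1
  | succ k ih =>
    have h1 : transitionOperator a (fun _ => 1) = fun _ => 1 := by
      funext x
      have := (totalConductance_pos ha x).ne'
      unfold transitionOperator
      rw [one_mul, one_mul, ← add_div]
      exact div_self this
    have := tsum_transitionOperator_mul ha (heatKernel_eq_zero_of_lt (a := a) k) fun _ => 1
    simp only [h1, mul_one] at this
    rw [heatKernel_succ, this, ih]

/-- Symmetry moves the steps one by one from the first factor to the second. -/
lemma tsum_heatKernel_mul_heatKernel (ha : ∀ x, 0 < a x) (k : ℕ) : ∀ l,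
    ∑' x, totalConductance a x * (heatKernel a k x * heatKernel a l x) =
      heatKernel a (k + l) 0 := by
  induction k with
  | zero => intro l; rw [tsum_heatKernel_zero_mul ha, zero_add]
  | succ k ih =>
    intro l
    rw [heatKernel_succ, tsum_transitionOperator_mul ha (heatKernel_eq_zero_of_lt k),
      ← heatKernel_succ, ih]
    congr 1
    omega

lemma twoStepEnergy_heatKernel (ha : ∀ x, 0 < a x) (n : ℕ) :
    twoStepEnergy a (heatKernel a n) = heatKernel a (2 * n) 0 - heatKernel a (2 * (n + 1)) 0 := by
  rw [twoStepEnergy_eq ha (heatKernel_eq_zero_of_lt n), ← heatKernel_succ,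
    tsum_heatKernel_mul_heatKernel ha, tsum_heatKernel_mul_heatKernel ha, two_mul, two_mul]

/-- The drop from `n` to `n + 1` is the squared weighted `ℓ²` norm of `h_n - h_{n+2}`. -/
lemma twoStepEnergy_heatKernel_antitone (ha : ∀ x, 0 < a x) :
    Antitone fun n => twoStepEnergy a (heatKernel a n) := by
  refine antitone_nat_of_succ_le fun n => ?_
  have s : ∀ k l, Summable fun x => totalConductance a x * (heatKernel a k x * heatKernel a l x) :=
    fun k l => summable_of_eq_zero_of_lt_natAbs k fun x hx => by
      rw [heatKernel_eq_zero_of_lt k x hx]; ring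
  have h : 0 ≤ ∑' x, totalConductance a x * (heatKernel a n x - heatKernel a (n + 2) x) ^ 2 :=
    tsum_nonneg fun x => mul_nonneg (totalConductance_pos ha x).le (sq_nonneg _)
  have e : ∀ x, totalConductance a x * (heatKernel a n x - heatKernel a (n + 2) x) ^ 2 =
      totalConductance a x * (heatKernel a n x * heatKernel a n x) -
      totalConductance a x * (heatKernel a n x * heatKernel a (n + 2) x) -
      totalConductance a x * (heatKernel a n x * heatKernel a (n + 2) x) +
      totalConductance a x * (heatKernel a (n + 2) x * heatKernel a (n + 2) x) := fun x => by ring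
  simp only [e] at h
  rw [(((s _ _).sub (s _ _)).sub (s _ _)).tsum_add (s _ _), ((s _ _).sub (s _ _)).tsum_sub (s _ _),
    (s _ _).tsum_sub (s _ _)] at h
  simp only [tsum_heatKernel_mul_heatKernel ha] at h
  rw [twoStepEnergy_heatKernel ha, twoStepEnergy_heatKernel ha]
  have e1 : n + n = 2 * n := by ring
  have e2 : n + (n + 2) = 2 * (n + 1) := by ring
  have e3 : n + 2 + (n + 2) = 2 * (n + 1 + 1) := by ring
  rw [e1, e2, e3] at h
  linarith

/-- The energies of `h_n, …, h_{2n-1}` telescope to `h_{2n}(0) - h_{4n}(0)`, and each is at least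
that of `h_{2n}`. -/
lemma nat_mul_twoStepEnergy_heatKernel_le (ha : ∀ x, 0 < a x) (n : ℕ) :
    n * twoStepEnergy a (heatKernel a (2 * n)) ≤ heatKernel a (2 * n) 0 := by
  have h : ∀ k ≤ n, k * twoStepEnergy a (heatKernel a (2 * n)) ≤
      heatKernel a (2 * n) 0 - heatKernel a (2 * (n + k)) 0 := by
    intro k
    induction k with
    | zero => simp
    | succ k ih =>
      intro hk
      have h1 := ih (by omega)
      have h2 := twoStepEnergy_heatKernel_antitone ha (show n + k ≤ 2 * n by omega)
      simp only [twoStepEnergy_heatKernel ha (n + k)] at h2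
      push_cast
      rw [← add_assoc]
      linarith
  linarith [h n le_rfl, heatKernel_nonneg ha (2 * (n + n)) 0]

/-- Oscillation estimate for the heat kernel in terms of its value at `0` and the resistance. -/
lemma nat_mul_sq_heatKernel_sub_le (ha : ∀ x, 0 < a x) (n : ℕ) {x y : ℤ} (hxy : Even (x - y))
    {M : ℕ} (hx : x.natAbs ≤ M) (hy : y.natAbs ≤ M) :
    n * (heatKernel a (2 * n) x - heatKernel a (2 * n) y) ^ 2 ≤
      heatKernel a (2 * n) 0 * ∑ z ∈ Finset.Ico (-(M : ℤ)) M, 1 / a z := by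
  have h1 := sq_sub_le_twoStepEnergy_mul_resistance ha (heatKernel_eq_zero_of_lt (a := a) (2 * n))
    hxy hx hy
  have h2 := nat_mul_twoStepEnergy_heatKernel_le ha n
  calc _ ≤ n * (twoStepEnergy a (heatKernel a (2 * n)) *
          ∑ z ∈ Finset.Ico (-(M : ℤ)) M, 1 / a z) := by gcongr
    _ = n * twoStepEnergy a (heatKernel a (2 * n)) *
          ∑ z ∈ Finset.Ico (-(M : ℤ)) M, 1 / a z := by ring
    _ ≤ _ := mul_le_mul_of_nonneg_right h2 (Finset.sum_nonneg fun z _ => (one_div_pos.2 (ha z)).le)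

/-- Any lower bound for the heat kernel at the even sites of `[-M, M]` is at most the inverse of the
total conductance there. -/
lemma sum_mul_le_one_of_le_heatKernel (ha : ∀ x, 0 < a x) (n M : ℕ) {b : ℝ}
    (hb : ∀ x : ℤ, Even x → x.natAbs ≤ M → b ≤ heatKernel a (2 * n) x) :
    (∑ z ∈ Finset.Ico (-(M : ℤ)) M, a z) * b ≤ 1 := by
  have nn := heatKernel_nonneg ha (2 * n)
  have s : Summable fun z => a z * (heatKernel a (2 * n) z + heatKernel a (2 * n) (z + 1)) :=
    summable_of_eq_zero_of_lt_natAbs (2 * n + 1) fun x hx => by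
      rw [heatKernel_eq_zero_of_lt _ _ (by omega), heatKernel_eq_zero_of_lt _ _ (by omega)]; ring
  rw [← tsum_heatKernel ha (2 * n), ← tsum_edge_eq_tsum_vertex (heatKernel_eq_zero_of_lt (2 * n)),
    Finset.sum_mul]
  refine le_trans (Finset.sum_le_sum fun z hz => ?_) (s.sum_le_tsum (Finset.Ico (-(M : ℤ)) M)
    fun z _ => mul_nonneg (ha z).le (add_nonneg (nn _) (nn _)))
  rw [Finset.mem_Ico] at hz
  refine mul_le_mul_of_nonneg_left ?_ (ha z).le
  -- Every edge has exactly one even endpoint, and that endpoint lies in `[-M, M]`.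
  rcases Int.even_or_odd z with h | h
  · linarith [hb z h (by omega), nn (z + 1)]
  · linarith [hb (z + 1) h.add_one (by omega), nn z]

end Walk

/-! ### Birkhoff sums of functions with negative mean -/

section Birkhoff

variable {Ω : Type*}

/-- The running maximum of `0` and the first `n` Birkhoff sums of `f`. -/
noncomputable def birkhoffMaximum (T : Ω → Ω) (f : Ω → ℝ) : ℕ → Ω → ℝ
  | 0 => fun _ => 0
  | n + 1 => fun ω => max 0 (f ω + birkhoffMaximum T f n (T ω))

lemma birkhoffSum_le_birkhoffMaximum (T : Ω → Ω) (f : Ω → ℝ) (n : ℕ) :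
    ∀ ω, birkhoffSum T f n ω ≤ birkhoffMaximum T f n ω := by
  induction n with
  | zero => intro ω; simp [birkhoffMaximum]
  | succ n ih =>
    intro ω
    rw [birkhoffSum_succ']
    exact le_max_of_le_right (by linarith [ih (T ω)])

lemma birkhoffMaximum_nonneg (T : Ω → Ω) (f : Ω → ℝ) (n : ℕ) (ω : Ω) :
    0 ≤ birkhoffMaximum T f n ω := by
  cases n
  exacts [le_rfl, le_max_left _ _]

lemma birkhoffMaximum_monotone (T : Ω → Ω) (f : Ω → ℝ) (ω : Ω) :
    Monotone fun n => birkhoffMaximum T f n ω := by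
  refine monotone_nat_of_le_succ fun n => ?_
  induction n generalizing ω with
  | zero => exact birkhoffMaximum_nonneg T f 1 ω
  | succ n ih => exact max_le_max le_rfl (by linarith [ih (T ω)])

/-- This invariance lets ergodicity apply a zero-one law to the event of boundedness. -/
lemma bddAbove_birkhoffMaximum_comp_iff (T : Ω → Ω) (f : Ω → ℝ) (ω : Ω) :
    BddAbove (Set.range fun n => birkhoffMaximum T f n (T ω)) ↔
      BddAbove (Set.range fun n => birkhoffMaximum T f n ω) := by
  constructor
  · rintro ⟨B, hB⟩
    refine ⟨max 0 (f ω + B), ?_⟩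
    rintro _ ⟨n, rfl⟩
    cases n with
    | zero => exact le_max_left _ _
    | succ n =>
      exact max_le_max le_rfl (by linarith [hB ⟨n, rfl⟩])
  · rintro ⟨B, hB⟩
    refine ⟨B - f ω, ?_⟩
    rintro _ ⟨n, rfl⟩
    have h1 : birkhoffMaximum T f (n + 1) ω ≤ B := hB ⟨n + 1, rfl⟩
    have h2 : f ω + birkhoffMaximum T f n (T ω) ≤ birkhoffMaximum T f (n + 1) ω := le_max_right _ _
    simp only
    linarith

variable [MeasurableSpace Ω] {μ : Measure Ω}

lemma measurable_birkhoffMaximum {T : Ω → Ω} (hT : Measurable T) {f : Ω → ℝ} (hf : Measurable f)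
    (n : ℕ) : Measurable (birkhoffMaximum T f n) := by
  induction n with
  | zero => exact measurable_const
  | succ n ih => exact measurable_const.max (hf.add (ih.comp hT))

lemma integrable_birkhoffMaximum {T : Ω → Ω} (hT : MeasurePreserving T μ μ)
    {f : Ω → ℝ} (hf : Integrable f μ) (n : ℕ) : Integrable (birkhoffMaximum T f n) μ := by
  induction n with
  | zero => exact integrable_zero _ _ _
  | succ n ih =>
    exact (integrable_zero _ _ _).sup (hf.add (hT.integrable_comp_of_integrable ih))

/-- A form of the maximal ergodic theorem: the Birkhoff sums of a function with negative mean are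
almost surely bounded above. -/
theorem Ergodic.ae_bddAbove_birkhoffSum {T : Ω → Ω} (hT : Ergodic T μ)
    {f : Ω → ℝ} (hfm : Measurable f) (hf : Integrable f μ) (hneg : ∫ ω, f ω ∂μ < 0) :
    ∀ᵐ ω ∂μ, BddAbove (Set.range fun n => birkhoffSum T f n ω) := by
  set M := birkhoffMaximum T f with hM
  set A : Set Ω := {ω | BddAbove (Set.range fun n => M n ω)} with hA
  have hAm : MeasurableSet A :=
    measurableSet_bddAbove_range fun n => measurable_birkhoffMaximum hT.measurable hfm n
  have hinv : T ⁻¹' A = A := Set.ext fun ω => bddAbove_birkhoffMaximum_comp_iff T f ω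
  have hint := integrable_birkhoffMaximum hT.toMeasurePreserving hf
  have hintT : ∀ n, Integrable (fun ω => M n (T ω)) μ := fun n =>
    hT.toMeasurePreserving.integrable_comp_of_integrable (hint n)
  rcases hT.toPreErgodic.ae_mem_or_ae_notMem hAm hinv with h | h
  · filter_upwards [h] with ω ⟨B, hB⟩
    refine ⟨B, ?_⟩
    rintro _ ⟨n, rfl⟩
    exact (birkhoffSum_le_birkhoffMaximum T f n ω).trans (hB ⟨n, rfl⟩)
  · exfalso
    -- If the maxima are a.e. unbounded, these differences converge to `f`, dominated by `|f|`.
    -- Their integrals are nonnegative, because `T` preserves `μ` and the maxima increase; hence `∫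
    -- f ≥ 0`.
    have eq : ∀ n ω, M (n + 1) ω - M n (T ω) = max (-M n (T ω)) (f ω) := fun n ω => by
      change max 0 (f ω + M n (T ω)) - M n (T ω) = _
      rw [← max_sub_sub_right]; simp
    have lim : Tendsto (fun n => ∫ ω, M (n + 1) ω - M n (T ω) ∂μ) atTop (𝓝 (∫ ω, f ω ∂μ)) := by
      refine tendsto_integral_of_dominated_convergence (fun ω => |f ω|)
        (fun n => ((hint (n + 1)).sub (hintT n)).aestronglyMeasurable) hf.abs
        (fun n => ae_of_all _ fun ω => ?_) ?_
      · have := birkhoffMaximum_nonneg T f n (T ω)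
        rw [eq, Real.norm_eq_abs, abs_le]
        exact ⟨(neg_abs_le _).trans (le_max_right _ _),
          max_le (by linarith [abs_nonneg (f ω)]) (le_abs_self _)⟩
      · filter_upwards [h] with ω hω
        have hTω : T ω ∉ A := fun h' => hω (hinv ▸ h')
        have ht := (tendsto_atTop_of_monotone (birkhoffMaximum_monotone T f (T ω))).resolve_right
          (by
            rintro ⟨l, hl⟩
            exact hTω hl.bddAbove_range)
        refine tendsto_const_nhds.congr' ?_
        filter_upwards [ht.eventually_ge_atTop (-f ω)] with n hn
        rw [eq, max_eq_right]
        change -M n (T ω) ≤ f ω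
        linarith
    refine hneg.not_ge (ge_of_tendsto' lim fun n => ?_)
    have hTn : ∫ ω, M n (T ω) ∂μ = ∫ ω, M n ω ∂μ := by
      have h1 := integral_map (μ := μ) hT.measurable.aemeasurable (f := M n)
        (measurable_birkhoffMaximum hT.measurable hfm n).aestronglyMeasurable
      rwa [hT.toMeasurePreserving.map_eq, eq_comm] at h1
    rw [integral_sub (hint _) (hintT n), hTn]
    exact sub_nonneg.2 (integral_mono (hint _) (hint _)
      fun ω => birkhoffMaximum_monotone T f ω n.le_succ)

/-- The Birkhoff sums of an integrable function grow at most linearly. -/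
theorem Ergodic.ae_exists_birkhoffSum_le [IsProbabilityMeasure μ] {T : Ω → Ω} (hT : Ergodic T μ)
    {f : Ω → ℝ} (hfm : Measurable f) (hf : Integrable f μ) :
    ∀ᵐ ω ∂μ, ∃ K : ℝ, ∀ n : ℕ, 1 ≤ n → birkhoffSum T f n ω ≤ K * n := by
  -- Any level above the mean would do; centring there makes the mean negative.
  set b := ∫ ω, f ω ∂μ + 1 with hb
  have h := hT.ae_bddAbove_birkhoffSum (f := fun ω => f ω - b) (hfm.sub_const _)
    (hf.sub (integrable_const _)) (by
      rw [integral_sub hf (integrable_const _)]; simp [hb])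
  filter_upwards [h] with ω ⟨B, hB⟩
  refine ⟨b + |B|, fun n hn => ?_⟩
  have h1 : birkhoffSum T (fun ω => f ω - b) n ω ≤ B := hB ⟨n, rfl⟩
  have h2 : birkhoffSum T (fun ω => f ω - b) n ω = birkhoffSum T f n ω - n * b := by
    simp [birkhoffSum, Finset.sum_sub_distrib]
  have h3 : (1 : ℝ) ≤ n := by exact_mod_cast hn
  nlinarith [le_abs_self B, abs_nonneg B]

/-- The Birkhoff sums of a nonnegative function of infinite mean grow faster than linearly. -/
theorem Ergodic.ae_eventually_mul_le_birkhoffSum [IsProbabilityMeasure μ] {T : Ω → Ω}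
    (hT : Ergodic T μ) {f : Ω → ℝ} (hfm : Measurable f) (h0 : ∀ ω, 0 ≤ f ω)
    (hf : ∫⁻ ω, ENNReal.ofReal (f ω) ∂μ = ⊤) :
    ∀ᵐ ω ∂μ, ∀ M : ℝ, ∀ᶠ n : ℕ in atTop, M * n ≤ birkhoffSum T f n ω := by
  have key : ∀ k : ℕ, ∀ᵐ ω ∂μ, ∀ᶠ n : ℕ in atTop, (k : ℝ) * n ≤ birkhoffSum T f n ω := by
    intro k
    have hL : Tendsto (fun L : ℕ => ∫⁻ ω, ENNReal.ofReal (min (f ω) L) ∂μ) atTop (𝓝 ⊤) := by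
      rw [← hf]
      refine lintegral_tendsto_of_tendsto_of_monotone
        (fun L => (hfm.min measurable_const).ennreal_ofReal.aemeasurable)
        (ae_of_all _ fun ω i j hij => ENNReal.ofReal_le_ofReal
          (min_le_min le_rfl (by exact_mod_cast hij))) (ae_of_all _ fun ω => ?_)
      refine tendsto_const_nhds.congr' ?_
      obtain ⟨L, hL⟩ := exists_nat_ge (f ω)
      filter_upwards [eventually_ge_atTop L] with n hn
      rw [min_eq_left (hL.trans (by exact_mod_cast hn))]
    -- Truncation at `L` gives an integrable function of mean above `k + 1`; the spare `1` yields a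
    -- term `n` that absorbs the bound `B`.
    obtain ⟨L, hL⟩ := ((tendsto_order.1 hL).1 (ENNReal.ofReal (k + 1))
      ENNReal.ofReal_lt_top).exists
    have hm : Measurable fun ω => min (f ω) (L : ℝ) := hfm.min measurable_const
    have hnn : ∀ ω, 0 ≤ min (f ω) (L : ℝ) := fun ω => le_min (h0 ω) L.cast_nonneg
    have hi : Integrable (fun ω => min (f ω) (L : ℝ)) μ :=
      (integrable_const (L : ℝ)).mono' hm.aestronglyMeasurable
        (ae_of_all _ fun ω => by
          rw [Real.norm_eq_abs, abs_of_nonneg (hnn ω)]; exact min_le_right _ _)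
    rw [← ofReal_integral_eq_lintegral_ofReal hi (ae_of_all _ hnn)] at hL
    have hL' := (ENNReal.ofReal_lt_ofReal_iff_of_nonneg (by positivity)).1 hL
    have h := hT.ae_bddAbove_birkhoffSum (f := fun ω => ((k : ℝ) + 1) - min (f ω) L)
      (measurable_const.sub hm) ((integrable_const _).sub hi) (by
        rw [integral_sub (integrable_const _) hi]; simpa using hL')
    filter_upwards [h] with ω ⟨B, hB⟩
    obtain ⟨N, hN⟩ := exists_nat_ge B
    filter_upwards [eventually_ge_atTop N] with n hn
    have h1 : birkhoffSum T (fun ω => ((k : ℝ) + 1) - min (f ω) L) n ω ≤ B := hB ⟨n, rfl⟩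
    have h2 : birkhoffSum T (fun ω => ((k : ℝ) + 1) - min (f ω) L) n ω =
        n * (k + 1) - birkhoffSum T (fun ω => min (f ω) (L : ℝ)) n ω := by
      simp [birkhoffSum, Finset.sum_sub_distrib, mul_add]
    have h3 : birkhoffSum T (fun ω => min (f ω) (L : ℝ)) n ω ≤ birkhoffSum T f n ω :=
      Finset.sum_le_sum fun i _ => min_le_left _ _
    have h4 : (N : ℝ) ≤ n := by exact_mod_cast hn
    linarith
  filter_upwards [ae_all_iff.2 key] with ω h M
  obtain ⟨k, hk⟩ := exists_nat_ge M
  filter_upwards [h k] with n hn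
  exact (mul_le_mul_of_nonneg_right hk n.cast_nonneg).trans hn

end Birkhoff

/-! ### Heat kernel bounds under linear growth of the resistance -/

section Bounds

variable {a : ℤ → ℝ} {K : ℝ}

lemma natCeil_le_two_mul {r : ℝ} (hr : 1 ≤ r) : ⌈r⌉₊ ≤ 2 * r := by
  linarith [Nat.ceil_lt_add_one (zero_le_one.trans hr)]

/-- `0 ≤ b` covers an empty ball, where the supremum is `0` by convention. -/
lemma maxOscillation_le {h : ℤ → ℝ} {x₀ : ℤ} {r b : ℝ} (hb : 0 ≤ b)
    (H : ∀ x : ℤ, |(x : ℝ) - x₀| < r → Even x → |h x - h x₀| ≤ b) :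
    maxOscillation h x₀ r ≤ b := by
  refine Real.sSup_le ?_ hb
  rintro _ ⟨x, ⟨hx, he⟩, rfl⟩
  exact H x hx he

lemma maxOscillation_nonneg (h : ℤ → ℝ) (x₀ : ℤ) (r : ℝ) : 0 ≤ maxOscillation h x₀ r := by
  refine Real.sSup_nonneg ?_
  rintro _ ⟨x, -, rfl⟩
  exact abs_nonneg _

lemma pos_of_resistance_le (ha : ∀ x, 0 < a x)
    (hK : ∀ M : ℕ, ∑ z ∈ Finset.Ico (-(M : ℤ)) M, 1 / a z ≤ K * M) : 0 < K := by
  have h : 0 < ∑ z ∈ Finset.Ico (-((1 : ℕ) : ℤ)) (1 : ℕ), 1 / a z :=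
    Finset.sum_pos (fun z _ => one_div_pos.2 (ha z)) ⟨0, by simp⟩
  simpa using h.trans_le (hK 1)

/-- On-diagonal upper bound, in terms of the total conductance of a box of size of order `√n`. -/
lemma sqrt_mul_heatKernel_le (ha : ∀ x, 0 < a x)
    (hK : ∀ M : ℕ, ∑ z ∈ Finset.Ico (-(M : ℤ)) M, 1 / a z ≤ K * M) {n M : ℕ} (hn : 1 ≤ n)
    {ρ β : ℝ} (hβ : 0 < β) (hM : M ≤ 2 * (ρ * √n))
    (hW : √n ≤ β * ∑ z ∈ Finset.Ico (-(M : ℤ)) M, a z) :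
    √n * heatKernel a (2 * n) 0 ≤ 2 * β + 2 * ρ * K := by
  have hK0 := pos_of_resistance_le ha hK
  have hn0 : (0 : ℝ) < n := by exact_mod_cast hn
  have hs : 0 < √(n : ℝ) := Real.sqrt_pos.2 hn0
  have hs2 : √(n : ℝ) ^ 2 = n := Real.sq_sqrt hn0.le
  have hu : 0 ≤ heatKernel a (2 * n) 0 := heatKernel_nonneg ha _ _
  set s := √(n : ℝ)
  set u := heatKernel a (2 * n) 0
  set W := ∑ z ∈ Finset.Ico (-(M : ℤ)) M, a z
  -- `t` bounds the deviation of `h_{2n}` from `u` at even sites of the box.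
  set t := √(u * (K * M) / n)
  have ht0 : 0 ≤ t := Real.sqrt_nonneg _
  have ht2 : t ^ 2 = u * (K * M) / n := Real.sq_sqrt (by positivity)
  have hlow : W * (u - t) ≤ 1 := by
    refine sum_mul_le_one_of_le_heatKernel ha n M fun x hx hxM => ?_
    have h1 := nat_mul_sq_heatKernel_sub_le ha n (x := x) (y := 0) (by simpa using hx) hxM
      (by simp)
    have h2 : (heatKernel a (2 * n) x - u) ^ 2 ≤ u * (K * M) / n := by
      rw [le_div_iff₀ hn0, mul_comm]
      exact h1.trans (mul_le_mul_of_nonneg_left (hK M) hu)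
    linarith [(abs_le.1 (Real.abs_le_sqrt h2)).1]
  -- AM-GM on `(s t)² ≤ 2 ρ K s u`; the term `s u / 2` is absorbed on the left at the end.
  have hst : s * t ≤ s * u / 2 + ρ * K := by
    have hρ : 0 ≤ ρ := by
      by_contra! h
      nlinarith [mul_pos (neg_pos.2 h) hs, (M.cast_nonneg : (0 : ℝ) ≤ M)]
    refine le_of_abs_le (abs_le_of_sq_le_sq ?_ (by positivity))
    have e : (s * t) ^ 2 = u * K * M := by
      rw [mul_pow, ht2, hs2]; field_simp
    have h1 : u * K * M ≤ u * K * (2 * (ρ * s)) := mul_le_mul_of_nonneg_left hM (by positivity)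
    rw [e]
    nlinarith [sq_nonneg (s * u / 2 - ρ * K)]
  have h3 : s * (u - t) ≤ β := by
    rcases le_total (u - t) 0 with h | h
    · nlinarith
    · calc s * (u - t) ≤ β * W * (u - t) := mul_le_mul_of_nonneg_right hW h
        _ = β * (W * (u - t)) := by ring
        _ ≤ β * 1 := mul_le_mul_of_nonneg_left hlow hβ.le
        _ = β := mul_one β
  linarith [mul_sub s u t]

/-- Cauchy–Schwarz for `1 = a · (1/a)` over the `2M` edges: low resistance forces high conductance.
-/
lemma four_mul_le_mul_sum (ha : ∀ x, 0 < a x)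
    (hK : ∀ M : ℕ, ∑ z ∈ Finset.Ico (-(M : ℤ)) M, 1 / a z ≤ K * M) (M : ℕ) :
    4 * M ≤ K * ∑ z ∈ Finset.Ico (-(M : ℤ)) M, a z := by
  rcases Nat.eq_zero_or_pos M with rfl | hM
  · simp
  have hM0 : (0 : ℝ) < M := by exact_mod_cast hM
  have h := Finset.sum_sq_le_sum_mul_sum_of_sq_le_mul (Finset.Ico (-(M : ℤ)) M)
    (r := fun _ => (1 : ℝ)) (f := a) (g := fun z => 1 / a z) (fun z _ => (ha z).le)
    (fun z _ => (one_div_pos.2 (ha z)).le) fun z _ => by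
      rw [mul_one_div_cancel (ha z).ne']; norm_num
  have hc : ∑ z ∈ Finset.Ico (-(M : ℤ)) M, (1 : ℝ) = 2 * M := by
    rw [Finset.sum_const, Int.card_Ico, nsmul_eq_mul, mul_one]
    have : ((M : ℤ) - -(M : ℤ)).toNat = 2 * M := by omega
    rw [this]; push_cast; ring
  rw [hc] at h
  have hW : 0 ≤ ∑ z ∈ Finset.Ico (-(M : ℤ)) M, a z := Finset.sum_nonneg fun z _ => (ha z).le
  have h2 := h.trans (mul_le_mul_of_nonneg_left (hK M) hW)
  refine le_of_mul_le_mul_right ?_ hM0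
  linarith

theorem sqrt_mul_heatKernel_le_three_mul (ha : ∀ x, 0 < a x)
    (hK : ∀ M : ℕ, ∑ z ∈ Finset.Ico (-(M : ℤ)) M, 1 / a z ≤ K * M) {n : ℕ} (hn : 1 ≤ n) :
    √n * heatKernel a (2 * n) 0 ≤ 3 * K := by
  have hK0 := pos_of_resistance_le ha hK
  have h1 : 1 ≤ √(n : ℝ) := Real.one_le_sqrt.2 (by exact_mod_cast hn)
  have h := sqrt_mul_heatKernel_le ha hK hn (M := ⌈√(n : ℝ)⌉₊) (ρ := 1) (β := K / 4)
    (by positivity) (by rw [one_mul]; exact natCeil_le_two_mul h1)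
    (by linarith [four_mul_le_mul_sum ha hK ⌈√(n : ℝ)⌉₊, Nat.le_ceil √(n : ℝ)])
  linarith

/-- Hölder continuity of the heat kernel. -/
theorem exists_maxOscillation_heatKernel_le (ha : ∀ x, 0 < a x)
    (hK : ∀ M : ℕ, ∑ z ∈ Finset.Ico (-(M : ℤ)) M, 1 / a z ≤ K * M) {x₀ : ℤ} (hx₀ : Even x₀) :
    ∃ C : ℝ, 0 < C ∧ ∀ δ : ℝ, 0 < δ → ∀ n : ℕ, 1 ≤ n →
      maxOscillation (heatKernel a (2 * n)) x₀ (δ * √(2 * (n : ℝ))) ≤ C * (√δ / √(n : ℝ)) := by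
  have hK0 := pos_of_resistance_le ha hK
  -- Factors: `3K` from the diagonal bound, `K` from the resistance, and the rest from a box radius
  -- at most `(|x₀| + 1) δ √(2n)`.
  set D : ℝ := 3 * K * K * (x₀.natAbs + 1) * √2 with hD
  have hD0 : 0 < D := by positivity
  refine ⟨√D, Real.sqrt_pos.2 hD0, fun δ hδ n hn => maxOscillation_le (by positivity) ?_⟩
  intro x hx hxe
  have hn0 : (0 : ℝ) < n := by exact_mod_cast hn
  have hu : 0 ≤ heatKernel a (2 * n) 0 := heatKernel_nonneg ha _ _
  rw [← Real.sqrt_div hδ.le, ← Real.sqrt_mul hD0.le]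
  -- For `x ≠ x₀`, `|x - x₀| ≥ 1` lets the offset `|x₀|` be absorbed multiplicatively, so `C` does
  -- not depend on `δ`.
  rcases eq_or_ne x x₀ with rfl | hne
  · simp
  refine Real.abs_le_sqrt ?_
  set M := x₀.natAbs + (x - x₀).natAbs with hM
  have h1 := nat_mul_sq_heatKernel_sub_le ha n (x := x) (y := x₀) (hxe.sub hx₀) (M := M)
    (by omega) (by omega)
  have hcast : (((x - x₀).natAbs : ℕ) : ℝ) = |(x : ℝ) - x₀| := by
    rw [Nat.cast_natAbs]; push_cast; rfl
  have h2 : (M : ℝ) ≤ (x₀.natAbs + 1) * (δ * (√2 * √n)) := by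
    have h3 : (1 : ℝ) ≤ (x - x₀).natAbs := by
      have : 1 ≤ (x - x₀).natAbs := by omega
      exact_mod_cast this
    have h4 : ((x - x₀).natAbs : ℝ) ≤ δ * (√2 * √n) := by
      rw [hcast, ← Real.sqrt_mul zero_le_two]; exact hx.le
    have h5 : (M : ℝ) ≤ (x₀.natAbs + 1) * (x - x₀).natAbs := by
      rw [hM]; push_cast
      nlinarith [(Nat.cast_nonneg x₀.natAbs : (0 : ℝ) ≤ x₀.natAbs)]
    exact h5.trans (mul_le_mul_of_nonneg_left h4 (by positivity))
  have h6 := sqrt_mul_heatKernel_le_three_mul ha hK hn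
  rw [← mul_div_assoc, le_div_iff₀ hn0, mul_comm]
  calc _ ≤ heatKernel a (2 * n) 0 * (K * M) := h1.trans (mul_le_mul_of_nonneg_left (hK M) hu)
    _ ≤ heatKernel a (2 * n) 0 * (K * ((x₀.natAbs + 1) * (δ * (√2 * √n)))) := by gcongr
    _ = (√n * heatKernel a (2 * n) 0) * (K * (x₀.natAbs + 1) * √2 * δ) := by ring
    _ ≤ 3 * K * (K * (x₀.natAbs + 1) * √2 * δ) := by gcongr
    _ = D * δ := by rw [hD]; ring

theorem tendsto_sqrt_mul_heatKernel (ha : ∀ x, 0 < a x)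
    (hK : ∀ M : ℕ, ∑ z ∈ Finset.Ico (-(M : ℤ)) M, 1 / a z ≤ K * M)
    (hW : ∀ L : ℝ, ∀ᶠ M : ℕ in atTop, L * M ≤ ∑ z ∈ Finset.Ico (-(M : ℤ)) M, a z) :
    Tendsto (fun n : ℕ => √(n : ℝ) * heatKernel a (2 * n) 0) atTop (𝓝 0) := by
  have hK0 := pos_of_resistance_le ha hK
  refine tendsto_order.2 ⟨fun η hη => Eventually.of_forall fun n =>
    hη.trans_le (mul_nonneg (Real.sqrt_nonneg _) (heatKernel_nonneg ha _ _)), fun η hη => ?_⟩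
  -- With `ρ = β = ε` the diagonal bound is `2ε(1 + K) = η/2`.
  set ε := η / (4 * (1 + K)) with hε
  have hε0 : 0 < ε := by positivity
  have hsq : Tendsto (fun n : ℕ => ε * √(n : ℝ)) atTop atTop :=
    (Real.tendsto_sqrt_atTop.comp tendsto_natCast_atTop_atTop).const_mul_atTop hε0
  filter_upwards [(tendsto_nat_ceil_atTop.comp hsq).eventually (hW (1 / ε ^ 2)),
    hsq.eventually_ge_atTop 1, eventually_ge_atTop 1] with n h1 h2 hn
  simp only [Function.comp_apply] at h1
  have h3 := Nat.le_ceil (ε * √(n : ℝ))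
  have h := sqrt_mul_heatKernel_le ha hK hn (M := ⌈ε * √(n : ℝ)⌉₊) (ρ := ε) (β := ε) hε0
    (natCeil_le_two_mul h2) (by
      calc √(n : ℝ) = ε * (1 / ε ^ 2 * (ε * √n)) := by field_simp
        _ ≤ ε * (1 / ε ^ 2 * ⌈ε * √(n : ℝ)⌉₊) := by gcongr
        _ ≤ _ := by gcongr)
  have h4 : ε * (4 * (1 + K)) = η := div_mul_cancel₀ _ (by positivity)
  linarith

/-- The heat kernel is uniformly `o(1 / √n)` near the diagonal if the conductances have infinite
mean. -/
theorem tendsto_sqrt_mul_maxOscillation_heatKernel (ha : ∀ x, 0 < a x)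
    (hK : ∀ M : ℕ, ∑ z ∈ Finset.Ico (-(M : ℤ)) M, 1 / a z ≤ K * M)
    (hW : ∀ L : ℝ, ∀ᶠ M : ℕ in atTop, L * M ≤ ∑ z ∈ Finset.Ico (-(M : ℤ)) M, a z) (x₀ : ℤ) :
    Tendsto (fun n : ℕ => √(2 * (n : ℝ)) *
      maxOscillation (heatKernel a (2 * n)) x₀ (√(2 * (n : ℝ)))) atTop (𝓝 0) := by
  have hK0 := pos_of_resistance_le ha hK
  have hv := tendsto_sqrt_mul_heatKernel ha hK hW
  set v : ℕ → ℝ := fun n => √(n : ℝ) * heatKernel a (2 * n) 0 with hvdef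
  set D : ℝ := K * (x₀.natAbs + √2) with hD
  have hlim : Tendsto (fun n => √2 * (v n + √(D * v n))) atTop (𝓝 0) := by
    have h1 : Tendsto (fun n => √(D * v n)) atTop (𝓝 0) := by
      simpa using (hv.const_mul D).sqrt
    simpa using (hv.add h1).const_mul √2
  refine tendsto_of_tendsto_of_tendsto_of_le_of_le' tendsto_const_nhds hlim
    (Eventually.of_forall fun n => mul_nonneg (Real.sqrt_nonneg _) (maxOscillation_nonneg _ _ _)) ?_
  filter_upwards [eventually_ge_atTop 1] with n hn
  have hn0 : (0 : ℝ) < n := by exact_mod_cast hn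
  have hs : 0 < √(n : ℝ) := Real.sqrt_pos.2 hn0
  have hs1 : 1 ≤ √(n : ℝ) := Real.one_le_sqrt.2 (by exact_mod_cast hn)
  have hs2 : √(n : ℝ) ^ 2 = n := Real.sq_sqrt hn0.le
  have nn := heatKernel_nonneg ha (2 * n)
  have hvn : 0 ≤ v n := mul_nonneg hs.le (nn 0)
  -- Since `x₀` may be odd, the values themselves are bounded rather than their differences; at odd
  -- sites they vanish.
  have bound : ∀ x : ℤ, |(x : ℝ) - x₀| ≤ √2 * √n →
      heatKernel a (2 * n) x ≤ (v n + √(D * v n)) / √n := by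
    intro x hx
    rcases Int.even_or_odd x with he | ho
    · have h1 := nat_mul_sq_heatKernel_sub_le ha n (x := x) (y := 0) (by simpa using he)
        (M := x.natAbs) le_rfl (by simp)
      have h2 : (x.natAbs : ℝ) ≤ (x₀.natAbs + √2) * √n := by
        rw [Nat.cast_natAbs, Nat.cast_natAbs]
        push_cast
        have h3 : |(x : ℝ)| ≤ |(x : ℝ) - x₀| + |(x₀ : ℝ)| := by
          simpa using abs_add_le ((x : ℝ) - x₀) x₀
        nlinarith [abs_nonneg (x₀ : ℝ)]
      have h4 : (√n * (heatKernel a (2 * n) x - heatKernel a (2 * n) 0)) ^ 2 ≤ D * v n := by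
        rw [mul_pow, hs2]
        calc _ ≤ heatKernel a (2 * n) 0 * (K * x.natAbs) :=
              h1.trans (mul_le_mul_of_nonneg_left (hK _) (nn 0))
          _ ≤ heatKernel a (2 * n) 0 * (K * ((x₀.natAbs + √2) * √n)) :=
              mul_le_mul_of_nonneg_left (mul_le_mul_of_nonneg_left h2 hK0.le) (nn 0)
          _ = D * v n := by rw [hD, hvdef]; ring
      have h5 := (abs_le.1 (Real.abs_le_sqrt h4)).2
      rw [le_div_iff₀ hs]
      linarith [show v n = √(n : ℝ) * heatKernel a (2 * n) 0 from rfl]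
    · rw [heatKernel_eq_zero_of_odd _ _ (by grind)]
      positivity
  have hmax : maxOscillation (heatKernel a (2 * n)) x₀ (√(2 * (n : ℝ))) ≤
      (v n + √(D * v n)) / √n := by
    refine maxOscillation_le (by positivity) fun x hx _ => ?_
    rw [Real.sqrt_mul zero_le_two] at hx
    have b1 := bound x hx.le
    have b2 := bound x₀ (by simp)
    rw [abs_le]
    constructor <;> linarith [nn x, nn x₀]
  calc _ ≤ √(2 * (n : ℝ)) * ((v n + √(D * v n)) / √n) := by gcongr
    _ = √2 * (v n + √(D * v n)) := by
      rw [Real.sqrt_mul zero_le_two]; field_simp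

end Bounds

/-! ### Stationary conductances -/

lemma sum_Ico_neg_eq_add (g : ℤ → ℝ) (M : ℕ) :
    ∑ z ∈ Finset.Ico (-(M : ℤ)) M, g z =
      ∑ i ∈ Finset.range M, g i + ∑ i ∈ Finset.range M, g (-((i : ℤ) + 1)) := by
  induction M with
  | zero => simp
  | succ M ih =>
    have : Finset.Ico (-((M + 1 : ℕ) : ℤ)) (M + 1 : ℕ) =
        insert (-((M : ℤ) + 1)) (insert (M : ℤ) (Finset.Ico (-(M : ℤ)) M)) := by
      ext z
      simp only [Finset.mem_insert, Finset.mem_Ico]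
      omega
    rw [this, Finset.sum_insert (by simp), Finset.sum_insert (by simp), ih,
      Finset.sum_range_succ, Finset.sum_range_succ]
    ring

section Stationary

variable {Ω : Type*} [MeasurableSpace Ω]

lemma conductance_natCast (T : Ω ≃ᵐ Ω) (c : Ω → ℝ) (ω : Ω) (i : ℕ) :
    conductance T c ω i = c (T^[i] ω) := by
  rw [conductance, zpow_natCast, ← Equiv.Perm.iterate_eq_pow]
  rfl

/-- The left half-line becomes a Birkhoff sum of `c ∘ T.symm` under `T.symm`. -/
lemma conductance_neg (T : Ω ≃ᵐ Ω) (c : Ω → ℝ) (ω : Ω) (i : ℕ) :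
    conductance T c ω (-((i : ℤ) + 1)) = c (T.symm (T.symm^[i] ω)) := by
  rw [conductance, ← Nat.cast_succ, zpow_neg, zpow_natCast, ← inv_pow,
    ← Equiv.Perm.iterate_eq_pow, Function.iterate_succ_apply']
  rfl

lemma ae_exists_resistance_le {μ : Measure Ω} [IsProbabilityMeasure μ] {T : Ω ≃ᵐ Ω}
    (hT : Ergodic T μ) {c : Ω → ℝ} (hc : Measurable c) (hi : Integrable (fun ω => 1 / c ω) μ) :
    ∀ᵐ ω ∂μ, ∃ K : ℝ, ∀ M : ℕ,
      ∑ z ∈ Finset.Ico (-(M : ℤ)) M, 1 / conductance T c ω z ≤ K * M := by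
  have hm : Measurable fun ω => 1 / c ω := measurable_const.div hc
  filter_upwards [hT.ae_exists_birkhoffSum_le hm hi, hT.symm.ae_exists_birkhoffSum_le
    (hm.comp T.symm.measurable) (hT.symm.toMeasurePreserving.integrable_comp_of_integrable hi)]
    with ω ⟨K₁, h₁⟩ ⟨K₂, h₂⟩
  refine ⟨K₁ + K₂, fun M => ?_⟩
  rcases Nat.eq_zero_or_pos M with rfl | hM
  · simp
  rw [sum_Ico_neg_eq_add, add_mul]
  simp only [conductance_natCast, conductance_neg]
  exact add_le_add (h₁ M hM) (h₂ M hM)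

/-- `c̄(0)` is `c ∘ T.symm + c`, and invariance gives both terms the same integral. -/
lemma lintegral_ofReal_eq_top_of_totalConductance {μ : Measure Ω} {T : Ω ≃ᵐ Ω}
    (hT : MeasurePreserving T μ μ) {c : Ω → ℝ} (hc : Measurable c) (hpos : ∀ ω, 0 < c ω)
    (h : ∫⁻ ω, ENNReal.ofReal (totalConductance (conductance T c ω) 0) ∂μ = ⊤) :
    ∫⁻ ω, ENNReal.ofReal (c ω) ∂μ = ⊤ := by
  have e : ∀ ω, ENNReal.ofReal (totalConductance (conductance T c ω) 0) =
      ENNReal.ofReal (c (T.symm ω)) + ENNReal.ofReal (c ω) := fun ω => by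
    rw [← ENNReal.ofReal_add (hpos _).le (hpos _).le]
    have h1 := conductance_neg T c ω 0
    have h2 := conductance_natCast T c ω 0
    simp only [Nat.cast_zero, zero_add, Function.iterate_zero, id] at h1 h2
    rw [totalConductance, zero_sub, h1, h2]
  simp only [e] at h
  rw [lintegral_add_right _ hc.ennreal_ofReal,
    (hT.symm T).lintegral_comp hc.ennreal_ofReal, ENNReal.add_eq_top, or_self] at h
  exact h

end Stationary

theorem mainTheorem5 {Ω : Type*} [MeasurableSpace Ω] (μ : Measure Ω) [IsProbabilityMeasure μ]
    (T : Ω ≃ᵐ Ω) (hT : Ergodic T μ)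
    (c : Ω → ℝ) (hc_meas : Measurable c) (hc_pos : ∀ ω, 0 < c ω)
    (hc_inv : Integrable (fun ω => 1 / c ω) μ) :
    (∀ᵐ ω ∂μ, ∀ x₀ : ℤ, Even x₀ → ∃ C : ℝ, 0 < C ∧ ∀ δ : ℝ, 0 < δ → ∀ n : ℕ, 1 ≤ n →
      maxOscillation (heatKernel (conductance T c ω) (2 * n)) x₀ (δ * √(2 * (n : ℝ)))
        ≤ C * (√δ / √(n : ℝ))) ∧
    ((∫⁻ ω, ENNReal.ofReal (totalConductance (conductance T c ω) 0) ∂μ = ⊤) →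
      ∀ᵐ ω ∂μ, ∀ x₀ : ℤ,
        Tendsto (fun n : ℕ => √(2 * (n : ℝ)) *
          maxOscillation (heatKernel (conductance T c ω) (2 * n)) x₀ (√(2 * (n : ℝ))))
          atTop (𝓝 0)) := by
  have hpos : ∀ ω x, 0 < conductance T c ω x := fun ω x => hc_pos _
  have hres := ae_exists_resistance_le hT hc_meas hc_inv
  refine ⟨?_, fun htop => ?_⟩
  · filter_upwards [hres] with ω ⟨K, hK⟩ x₀ hx₀
    exact exists_maxOscillation_heatKernel_le (hpos ω) hK hx₀
  · have hinf := lintegral_ofReal_eq_top_of_totalConductance hT.toMeasurePreserving hc_meas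
      hc_pos htop
    filter_upwards [hres, hT.ae_eventually_mul_le_birkhoffSum hc_meas (fun ω => (hc_pos ω).le)
      hinf] with ω ⟨K, hK⟩ hW x₀
    refine tendsto_sqrt_mul_maxOscillation_heatKernel (hpos ω) hK (fun L => ?_) x₀
    -- The right half of the box alone already has superlinear conductance.
    filter_upwards [hW L] with M hM
    rw [sum_Ico_neg_eq_add]
    simp only [conductance_natCast]
    exact hM.trans (le_add_of_nonneg_right (Finset.sum_nonneg fun i _ => (hpos ω _).le))
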